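/- For a finite simple graph $G=(V,E)$, the Gram dimension $\mathrm{gd}(G)$ is the smallest integer $k\ge 1$ such that for every real symmetric positive semidefinite matrix $X$ indexed by $V$ there exists a real symmetric positive semidefinite matrix $X'$ indexed by $V$, of rank at most $k$, with $X'_{ii}=X_{ii}$ for all $i\in V$ and $X'_{ij}=X_{ij}$ for all edges $ij\in E$. **Theorem 5.1.** Let $C_5\times C_2$ be the pentagonal prism, that is, the graph with vertex set $\mathbb{Z}/5\mathbb{Z}\times\{0,1\}$ in which $(i,s)$ and $(j,t)$ are adjacent if and only if either $s=t$ and $j=i\pm1$, or $i=j$ and $s\neq t$. Then $\mathrm{gd}(C_5\times C_2)=4$. -/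

import Mathlib

/-- Two real square matrices indexed by the vertices of `G` have the same projection onto the
diagonal positions and the positions of the edges of `G`, i.e. they complete the same
`G`-partial matrix. -/
def SameGPartial {V : Type*} (G : SimpleGraph V) (X Y : Matrix V V ℝ) : Prop :=
  (∀ i, X i i = Y i i) ∧ ∀ i j, G.Adj i j → X i j = Y i j

/-- Every `G`-partial real symmetric matrix that has a positive semidefinite completion has a
positive semidefinite completion of rank at most `k`. -/
def HasLowRankCompletions {V : Type*} [Fintype V] (G : SimpleGraph V) (k : ℕ) : Prop :=
  ∀ X : Matrix V V ℝ, X.PosSemidef →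
    ∃ Y : Matrix V V ℝ, Y.PosSemidef ∧ Y.rank ≤ k ∧ SameGPartial G X Y

/-- The Gram dimension of a finite graph: the smallest integer `k ≥ 1` such that every
`G`-partial matrix with a positive semidefinite completion has one of rank at most `k`. -/
noncomputable def gramDim {V : Type*} [Fintype V] (G : SimpleGraph V) : ℕ :=
  sInf {k : ℕ | 1 ≤ k ∧ HasLowRankCompletions G k}

/-- The minimum in the definition of the Gram dimension is attained (the set is non-empty), so
no default value of `sInf` is involved. -/
theorem gramDim_isLeast {V : Type*} [Fintype V] (G : SimpleGraph V) :
    IsLeast {k : ℕ | 1 ≤ k ∧ HasLowRankCompletions G k} (gramDim G) := by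
  have hne : {k : ℕ | 1 ≤ k ∧ HasLowRankCompletions G k}.Nonempty :=
    ⟨Fintype.card V + 1, by omega, fun X hX =>
      ⟨X, hX, (Matrix.rank_le_card_width X).trans (Nat.le_succ _),
        fun _ => rfl, fun _ _ _ => rfl⟩⟩
  exact ⟨Nat.sInf_mem hne, fun _ hk => Nat.sInf_le hk⟩

/-- The pentagonal prism `C₅ × C₂`: the Cartesian (box) product of the 5-cycle with the graph
`C₂`, a single edge on two vertices. Two copies of the 5-cycle, corresponding
vertices being joined. -/
def pentagonalPrism : SimpleGraph (Fin 5 × Fin 2) :=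
  (SimpleGraph.cycleGraph 5).boxProd (SimpleGraph.completeGraph (Fin 2))

/-! Write aᵢ = (i,0) and bᵢ = (i,1).

Upper bound. By compactness it suffices to realize a positive definite `X₀`, on the diagonal and the
edges, by vectors in ℝ⁴. Among its positive semidefinite completions take one maximizing the sum of
the entries at the non-edges a₀b₂ and a₂b₄. Duality (`exists_completion_with_stress`) yields a
positive semidefinite stress Ω, supported on the diagonal, the edges and these two non-edges, and
nonzero on both. Complementary slackness (`exists_gram_in_equilibrium`) puts the Gram vectors in
equilibrium: ∑ Ω_xy p_y = 0 over y, for each x.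

Each equilibrium relation expresses any vector with nonzero coefficient through the others, so a few
vectors can generate all those in the set T of vertices meeting off-diagonal stress. Vectors of
adjacent vertices are not parallel, which excludes stress patterns where a vertex has a single
neighbour, joined to it by an edge. An enumeration of the patterns of stressed edges
(`explore_prismStages`) shows that four vectors always generate T, and that three suffice if two
vertices outside T are adjacent (`exists_spanning_of_stress`).

The vectors of T thus lie in a four-dimensional space M. A vector with at most three prescribed
inner products can be moved into M (`exists_mem_of_card_le_three`). If the complement of T is
independent this places all remaining vertices; otherwise the spare dimension allows two further
vertices to be placed beforehand (`exists_placement_of_spanning`).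

Lower bound. Contracting the prism to K₄ forces a 4 × 4 identity submatrix in every completion of a
suitable Gram matrix. -/

/-! ### Closure of vertex sets under linear relations, in bit masks. -/

/-- Evaluate the number `n` before passing it to `f`; this only matters for kernel reduction. -/
def forceNat {α : Type} (n : ℕ) (f : ℕ → α) : α :=
  match n with
  | 0 => f 0
  | Nat.succ k => f (Nat.succ k)

theorem forceNat_eq {α : Type} (n : ℕ) (f : ℕ → α) : forceNat n f = f n := by
  cases n <;> rfl

def forceList {α : Type} : List ℕ → (List ℕ → α) → α
  | [], f => f []
  | a :: l, f => forceNat a fun a' => forceList l fun l' => f (a' :: l')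

theorem forceList_eq {α : Type} (l : List ℕ) (f : List ℕ → α) : forceList l f = f l := by
  induction l generalizing f with
  | nil => rfl
  | cons a l ih => simp only [forceList, forceNat_eq, ih]

/-- Sets of natural numbers are encoded by their bit masks. If all but at most one element of `r`
belong to `K`, add `r` to `K`. -/
def closureStep (K r : ℕ) : ℕ :=
  forceNat ((r ||| K) ^^^ K) fun x => bif (x &&& (x - 1)).beq 0 then r ||| K else K

def closureSweep : List ℕ → ℕ → ℕ
  | [], K => K
  | r :: l, K => forceNat (closureStep K r) (closureSweep l)

def closureIter (rels : List ℕ) : ℕ → ℕ → ℕ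
  | 0, K => K
  | n + 1, K => forceNat (closureSweep rels K) (closureIter rels n)

/-- Three rounds of closing `K` under the relations `rels` reach all of `T`. -/
def generates (rels : List ℕ) (T K : ℕ) : Bool :=
  forceNat (closureIter rels 3 K) fun K' => (K' ||| T).beq K'

section Closure

variable {E : Type*} [AddCommGroup E] [Module ℝ E]

/-- Whenever all vectors indexed by the bits of `r` but one lie in `M`, so does the last one. -/
def ClosedUnder (vec : ℕ → E) (M : Submodule ℝ E) (r : ℕ) : Prop :=
  ∀ j, r.testBit j → (∀ i, i ≠ j → r.testBit i → vec i ∈ M) → vec j ∈ M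

def MaskIn (vec : ℕ → E) (M : Submodule ℝ E) (K : ℕ) : Prop :=
  ∀ j, K.testBit j → vec j ∈ M

/-- The operation x &&& (x - 1) clears the lowest set bit, so the result is zero only if at most one
bit is set. -/
theorem testBit_unique_of_and_sub_one {x : ℕ} (hx : x &&& (x - 1) = 0) {i j : ℕ}
    (hi : x.testBit i) (hj : x.testBit j) : i = j := by
  have h0 : x ≠ 0 := by rintro rfl; simp at hi
  obtain ⟨k, rfl⟩ := (Nat.and_sub_one_eq_zero_iff_isPowerOfTwo h0).1 hx
  rw [Nat.testBit_two_pow] at hi hj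
  simp at hi hj
  omega

theorem maskIn_closureStep {vec : ℕ → E} {M : Submodule ℝ E} {K r : ℕ}
    (hr : ClosedUnder vec M r) (hK : MaskIn vec M K) : MaskIn vec M (closureStep K r) := by
  rw [closureStep, forceNat_eq]
  cases h : ((((r ||| K) ^^^ K) &&& (((r ||| K) ^^^ K) - 1)).beq 0)
  · simpa using hK
  · have hx := Nat.eq_of_beq_eq_true h
    simp only [cond_true]
    intro j hj
    by_cases hjK : K.testBit j
    · exact hK j hjK
    · have hjr : r.testBit j := by simpa [Nat.testBit_or, hjK] using hj
      refine hr j hjr fun i hij hi => ?_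
      by_contra hiM
      have hiK : ¬ K.testBit i := fun h => hiM (hK i h)
      exact hij (testBit_unique_of_and_sub_one hx (by simp_all [Nat.testBit_or, Nat.testBit_xor])
        (by simp_all [Nat.testBit_or, Nat.testBit_xor]))

theorem maskIn_closureSweep {vec : ℕ → E} {M : Submodule ℝ E} {rels : List ℕ}
    (hr : ∀ r ∈ rels, ClosedUnder vec M r) {K : ℕ} (hK : MaskIn vec M K) :
    MaskIn vec M (closureSweep rels K) := by
  induction rels generalizing K with
  | nil => exact hK
  | cons r l ih =>
    rw [closureSweep, forceNat_eq]
    exact ih (fun r h => hr r (List.mem_cons_of_mem _ h))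
      (maskIn_closureStep (hr r List.mem_cons_self) hK)

theorem maskIn_closureIter {vec : ℕ → E} {M : Submodule ℝ E} {rels : List ℕ}
    (hr : ∀ r ∈ rels, ClosedUnder vec M r) (n : ℕ) {K : ℕ} (hK : MaskIn vec M K) :
    MaskIn vec M (closureIter rels n K) := by
  induction n generalizing K with
  | zero => exact hK
  | succ n ih =>
    rw [closureIter, forceNat_eq]
    exact ih (maskIn_closureSweep hr hK)

theorem maskIn_of_generates {vec : ℕ → E} {M : Submodule ℝ E} {rels : List ℕ} {T K : ℕ}
    (h : generates rels T K = true) (hr : ∀ r ∈ rels, ClosedUnder vec M r)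
    (hK : MaskIn vec M K) : MaskIn vec M T := by
  rw [generates, forceNat_eq] at h
  have h' := Nat.eq_of_beq_eq_true h
  intro j hj
  refine maskIn_closureIter hr 3 hK j ?_
  rw [← h', Nat.testBit_or, hj, Bool.or_true]

end Closure

/-! ### Enumeration of the stress patterns on the fifteen edges. -/

/-- A vertex of the prism with its number `i + 5 s`, the mask of the vertex joined to it by one of
the two stretched non-edges (if any), and the list of its edges, each given by its number and the
other endpoint. -/
abbrev PrismRow := ℕ × ℕ × List (ℕ × ℕ)

def rowMask (m : ℕ) (d : PrismRow) : ℕ :=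
  d.2.2.foldl (fun acc e => acc ||| (((m >>> e.1) &&& 1) <<< e.2)) d.2.1

/-- The vertex of the row has exactly one neighbour in the pattern `m`, along an edge. -/
def hasLeaf (m : ℕ) (d : PrismRow) : Bool :=
  forceNat (rowMask m d) fun r => d.2.2.any fun e => r.beq (2 ^ e.2)

def closedRow (m : ℕ) (d : PrismRow) : ℕ :=
  forceNat (rowMask m d) fun r => bif r.beq 0 then 0 else r ||| 2 ^ d.1

def rowA0 : PrismRow := (0, 2 ^ 7, [(0, 1), (5, 4), (6, 5)])
def rowA1 : PrismRow := (1, 0, [(1, 2), (0, 0), (2, 6)])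
def rowA2 : PrismRow := (2, 2 ^ 9, [(11, 3), (1, 1), (14, 7)])
def rowA3 : PrismRow := (3, 0, [(8, 4), (11, 2), (12, 8)])
def rowA4 : PrismRow := (4, 0, [(5, 0), (8, 3), (9, 9)])
def rowB0 : PrismRow := (5, 0, [(3, 6), (7, 9), (6, 0)])
def rowB1 : PrismRow := (6, 0, [(4, 7), (3, 5), (2, 1)])
def rowB2 : PrismRow := (7, 2 ^ 0, [(13, 8), (4, 6), (14, 2)])
def rowB3 : PrismRow := (8, 0, [(10, 9), (13, 7), (12, 3)])
def rowB4 : PrismRow := (9, 2 ^ 2, [(7, 5), (10, 8), (9, 4)])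

def prismTable : List PrismRow :=
  [rowA0, rowA1, rowA2, rowA3, rowA4, rowB0, rowB1, rowB2, rowB3, rowB4]

def supportMask (rels : List ℕ) : ℕ := rels.foldl (fun a b => a ||| b) 0

/-- Two adjacent vertices outside `T` exist (given that `T` contains `a₀, a₂, b₂, b₄`). -/
def adjacentOutside (T : ℕ) : Bool :=
  ((T &&& 2 ^ 6).beq 0 && ((T &&& 2 ^ 1).beq 0 || (T &&& 2 ^ 5).beq 0)) ||
    ((T &&& 2 ^ 3).beq 0 && ((T &&& 2 ^ 4).beq 0 || (T &&& 2 ^ 8).beq 0))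

/-- Candidate generating sets; that one of them always works is part of the enumeration. -/
def tripleMasks : List ℕ :=
  [2 ^ 0 + 2 ^ 2 + 2 ^ 9, 2 ^ 0 + 2 ^ 7 + 2 ^ 9, 2 ^ 0 + 2 ^ 1 + 2 ^ 4, 2 ^ 1 + 2 ^ 2 + 2 ^ 7,
    2 ^ 0 + 2 ^ 2 + 2 ^ 3]

def quadrupleMasks : List ℕ :=
  [2 ^ 0 + 2 ^ 3 + 2 ^ 6 + 2 ^ 9, 2 ^ 0 + 2 ^ 1 + 2 ^ 4 + 2 ^ 5]

def patternOk (m : ℕ) : Bool :=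
  forceList (prismTable.map (closedRow m)) fun rels =>
    forceNat (supportMask rels) fun T =>
      bif adjacentOutside T then tripleMasks.any (generates rels T)
      else quadrupleMasks.any (generates rels T)

/-- Check all patterns extending `m`, cutting off those with a leaf. -/
def explore : List (ℕ × List PrismRow) → ℕ → Bool
  | [], m => patternOk m
  | (p, ds) :: L, m =>
    (ds.any (hasLeaf m) || explore L m) &&
      forceNat (m + p) fun m' => ds.any (hasLeaf m') || explore L m'

/-- The edges in the order in which `explore` decides them, with the vertices all of whose edges
have then been decided. -/
def prismStages : List (ℕ × List PrismRow) :=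
  [(2 ^ 0, []), (2 ^ 1, []), (2 ^ 2, [rowA1]), (2 ^ 3, []),
    (2 ^ 4, [rowB1]), (2 ^ 5, []), (2 ^ 6, [rowA0]), (2 ^ 7, [rowB0]),
    (2 ^ 8, []), (2 ^ 9, [rowA4]), (2 ^ 10, [rowB4]), (2 ^ 11, []),
    (2 ^ 12, [rowA3]), (2 ^ 13, [rowB3]), (2 ^ 14, [rowA2, rowB2])]

/-- The computational core, evaluated by the kernel. Branches are cut as soon as a fully decided
vertex is a leaf. -/
theorem explore_prismStages : explore prismStages 0 = true := by decide +kernel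

/-! ### Translation between bit masks and the graph. -/

abbrev PrismVertex := Fin 5 × Fin 2

instance : DecidableRel pentagonalPrism.Adj := fun x y =>
  decidable_of_iff
    (((y.1 = x.1 + 1 ∨ x.1 = y.1 + 1) ∧ x.2 = y.2) ∨ (x.2 ≠ y.2 ∧ x.1 = y.1)) (by
      revert x y
      simp only [pentagonalPrism, SimpleGraph.boxProd_adj, SimpleGraph.cycleGraph_adj,
        SimpleGraph.completeGraph, SimpleGraph.top_adj]
      decide)

def prismCode (x : PrismVertex) : ℕ := x.1 + 5 * x.2

theorem prismCode_injective : Function.Injective prismCode := by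
  intro x y
  revert x y
  decide

def prismVertex (n : ℕ) : PrismVertex := (Fin.ofNat 5 n, Fin.ofNat 2 (n / 5))

theorem prismVertex_prismCode (x : PrismVertex) : prismVertex (prismCode x) = x := by
  revert x
  decide

/-- The two non-edges `a₀b₂` and `a₂b₄` whose sum of entries is maximized. -/
def stretched (x y : PrismVertex) : Bool :=
  [(0, 7), (7, 0), (2, 9), (9, 2)].contains (prismCode x, prismCode y)

def prismEdges : List (ℕ × ℕ) :=
  [(0, 1), (1, 2), (1, 6), (5, 6), (6, 7), (4, 0), (0, 5), (9, 5), (3, 4), (4, 9), (8, 9), (2, 3),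
    (3, 8), (7, 8), (2, 7)]

def prismEdge (k : ℕ) : PrismVertex × PrismVertex :=
  (prismVertex (prismEdges.getD k (0, 0)).1, prismVertex (prismEdges.getD k (0, 0)).2)

theorem exists_row (x : PrismVertex) : ∃ d ∈ prismTable, d.1 = prismCode x := by
  revert x
  decide

theorem exists_vertex_of_row : ∀ d ∈ prismTable, ∃ x : PrismVertex, d.1 = prismCode x := by
  decide

theorem row_edges_of_adj : ∀ d ∈ prismTable, ∀ x y : PrismVertex, d.1 = prismCode x →
    pentagonalPrism.Adj x y → ∃ e ∈ d.2.2, e.2 = prismCode y ∧ e.1 < 15 ∧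
      (prismEdge e.1 = (x, y) ∨ prismEdge e.1 = (y, x)) := by
  decide

theorem adj_of_row_edges : ∀ d ∈ prismTable, ∀ x : PrismVertex, d.1 = prismCode x → ∀ e ∈ d.2.2,
    ∃ y, pentagonalPrism.Adj x y ∧ e.2 = prismCode y ∧ e.1 < 15 ∧
      (prismEdge e.1 = (x, y) ∨ prismEdge e.1 = (y, x)) := by
  decide

set_option synthInstance.maxHeartbeats 200000 in
set_option synthInstance.maxSize 1024 in
theorem row_base_eq : ∀ d ∈ prismTable, ∀ x : PrismVertex, d.1 = prismCode x →
    (d.2.1 = 0 ∧ ∀ y, stretched x y = false) ∨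
      ∃ z : PrismVertex, d.2.1 = 2 ^ prismCode z ∧ ∀ y, stretched x y = true ↔ y = z := by
  decide

theorem not_adj_of_stretched : ∀ x y : PrismVertex, stretched x y = true →
    ¬ pentagonalPrism.Adj x y ∧ x ≠ y := by
  decide

theorem row_base_testBit {d : PrismRow} (hd : d ∈ prismTable) {x : PrismVertex}
    (hx : d.1 = prismCode x) (j : ℕ) :
    d.2.1.testBit j = true ↔ ∃ y : PrismVertex, j = prismCode y ∧ stretched x y = true := by
  rcases row_base_eq d hd x hx with ⟨h, hy⟩ | ⟨z, h, hy⟩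
  · simp [h, hy]
  · rw [h, Nat.testBit_two_pow]
    simp only [hy, decide_eq_true_eq]
    constructor
    · rintro rfl; exact ⟨z, rfl, rfl⟩
    · rintro ⟨y, rfl, rfl⟩; rfl

theorem rowMask_testBit (m : ℕ) (d : PrismRow) (j : ℕ) :
    (rowMask m d).testBit j = true ↔
      d.2.1.testBit j = true ∨ ∃ e ∈ d.2.2, e.2 = j ∧ m.testBit e.1 = true := by
  obtain ⟨v, b, es⟩ := d
  simp only [rowMask]
  induction es generalizing b with
  | nil => simp
  | cons e l ih =>
    rw [List.foldl_cons, ih]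
    have h : ((m >>> e.1 &&& 1) <<< e.2).testBit j = true ↔ e.2 = j ∧ m.testBit e.1 = true := by
      rw [Nat.testBit_shiftLeft]
      rcases lt_trichotomy e.2 j with h | h | h
      · have : (1 : ℕ).testBit (j - e.2) = false := by
          rw [← Bool.not_eq_true, Nat.testBit_one_eq_true_iff_self_eq_zero]; omega
        rw [Nat.testBit_and, this]
        simp [h.ne]
      · subst h; simp
      · simp [h.ne', Nat.not_le.2 h]
    simp only [Nat.testBit_or, Bool.or_eq_true, h, List.mem_cons, exists_eq_or_imp]
    tauto

theorem rowMask_mod (M t : ℕ) (d : PrismRow) (h : ∀ e ∈ d.2.2, e.1 < t) :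
    rowMask (M % 2 ^ t) d = rowMask M d := by
  refine Nat.eq_of_testBit_eq fun j => ?_
  rw [Bool.eq_iff_iff, rowMask_testBit, rowMask_testBit]
  refine or_congr Iff.rfl (exists_congr fun e => and_congr_right fun he => ?_)
  simp [Nat.testBit_mod_two_pow, h e he]

theorem hasLeaf_mod (M t : ℕ) (d : PrismRow) (h : ∀ e ∈ d.2.2, e.1 < t) :
    hasLeaf (M % 2 ^ t) d = hasLeaf M d := by
  simp only [hasLeaf, forceNat_eq, rowMask_mod M t d h]

/-- The stages decide the bits `s, s + 1, …` in order and test only decided rows. -/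
def StagesFrom : ℕ → List (ℕ × List PrismRow) → Prop
  | _, [] => True
  | s, (p, ds) :: L =>
    p = 2 ^ s ∧ (∀ d ∈ ds, d ∈ prismTable ∧ ∀ e ∈ d.2.2, e.1 < s + 1) ∧ StagesFrom (s + 1) L

theorem stagesFrom_prismStages : StagesFrom 0 prismStages := by
  simp only [prismStages, StagesFrom]
  and_intros <;> trivial

/-- The search is followed along the branch of `M`, whose state after s decisions is `M % 2 ^ s`. A
row tested there depends only on decided bits, so a leaf would be a leaf of `M` itself and this
branch is never cut. -/
theorem patternOk_of_explore {M : ℕ} (hM : ∀ d ∈ prismTable, hasLeaf M d = false)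
    (L : List (ℕ × List PrismRow)) (s : ℕ) (hL : StagesFrom s L)
    (h : explore L (M % 2 ^ s) = true) : patternOk (M % 2 ^ (s + L.length)) = true := by
  induction L generalizing s with
  | nil => simpa [explore] using h
  | cons q L ih =>
    obtain ⟨p, ds⟩ := q
    obtain ⟨rfl, hds, hL'⟩ := hL
    have hleaf : ds.any (hasLeaf (M % 2 ^ (s + 1))) = false := by
      rw [List.any_eq_false]
      intro d hd
      rw [hasLeaf_mod M (s + 1) d (hds d hd).2, hM d (hds d hd).1]
      simp
    have hnext : explore L (M % 2 ^ (s + 1)) = true := by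
      simp only [explore, forceNat_eq, Bool.and_eq_true] at h
      have hmod := Nat.mod_pow_succ (x := M) (b := 2) (k := s)
      have hbit := Nat.testBit_eq_decide_div_mod_eq (x := M) (i := s)
      cases hb : M.testBit s
      · have e : M % 2 ^ (s + 1) = M % 2 ^ s := by
          rw [hb, eq_comm, decide_eq_false_iff_not] at hbit
          rw [hmod, show M / 2 ^ s % 2 = 0 by omega, mul_zero, add_zero]
        rw [e] at hleaf ⊢
        simpa [hleaf] using h.1
      · have e : M % 2 ^ (s + 1) = M % 2 ^ s + 2 ^ s := by
          rw [hb, eq_comm, decide_eq_true_eq] at hbit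
          rw [hmod, hbit, mul_one]
        rw [e] at hleaf ⊢
        simpa [hleaf] using h.2
    have := ih (s + 1) hL' hnext
    rwa [List.length_cons, add_comm L.length, ← add_assoc]

theorem patternOk_of_no_leaf {m : ℕ} (hm : m < 2 ^ 15)
    (hleaf : ∀ d ∈ prismTable, hasLeaf m d = false) : patternOk m = true := by
  have h := patternOk_of_explore hleaf prismStages 0 stagesFrom_prismStages
    (by simpa [Nat.mod_one] using explore_prismStages)
  have e : 0 + prismStages.length = 15 := rfl
  rwa [e, Nat.mod_eq_of_lt hm] at h

theorem supportMask_testBit (rels : List ℕ) (j : ℕ) :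
    (supportMask rels).testBit j = true ↔ ∃ r ∈ rels, r.testBit j = true := by
  have h : ∀ (l : List ℕ) (b : ℕ), (l.foldl (fun a b => a ||| b) b).testBit j = true ↔
      b.testBit j = true ∨ ∃ r ∈ l, r.testBit j = true := by
    intro l
    induction l with
    | nil => simp
    | cons r l ih =>
      intro b
      rw [List.foldl_cons, ih]
      simp only [Nat.testBit_or, Bool.or_eq_true, List.mem_cons, exists_eq_or_imp]
      tauto
  simpa [supportMask] using h rels 0

theorem beq_land_two_pow_eq_false {T k : ℕ} :
    (T &&& 2 ^ k).beq 0 = false ↔ T.testBit k = true := by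
  rw [Nat.and_two_pow, ← Bool.not_eq_true, Nat.beq_eq]
  cases T.testBit k <;> simp

theorem mem_adjacent_pairs : ∀ x y : PrismVertex, pentagonalPrism.Adj x y →
    prismCode x ∉ [0, 2, 7, 9] → prismCode y ∉ [0, 2, 7, 9] →
    (prismCode x, prismCode y) ∈
      [(1, 6), (6, 1), (5, 6), (6, 5), (3, 4), (4, 3), (3, 8), (8, 3)] := by
  decide

theorem not_adj_of_adjacentOutside_eq_false {T : ℕ} (h : adjacentOutside T = false)
    (hT : ∀ k ∈ [0, 2, 7, 9], T.testBit k = true) (x y : PrismVertex)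
    (hx : ¬ T.testBit (prismCode x) = true) (hy : ¬ T.testBit (prismCode y) = true) :
    ¬ pentagonalPrism.Adj x y := by
  intro hxy
  have hmem := mem_adjacent_pairs x y hxy (fun h => hx (hT _ h)) (fun h => hy (hT _ h))
  simp only [adjacentOutside, Bool.or_eq_false_iff, Bool.and_eq_false_iff,
    beq_land_two_pow_eq_false] at h
  simp only [List.mem_cons, Prod.mk.injEq, List.not_mem_nil, or_false] at hmem
  rcases hmem with h' | h' | h' | h' | h' | h' | h' | h' <;> rw [h'.1] at hx <;>
    rw [h'.2] at hy <;> tauto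

def maskVertices (K : ℕ) : Finset PrismVertex :=
  Finset.univ.filter fun x => K.testBit (prismCode x) = true

theorem card_maskVertices_triple : ∀ K ∈ tripleMasks, (maskVertices K).card ≤ 3 := by
  decide

theorem card_maskVertices_quadruple : ∀ K ∈ quadrupleMasks, (maskVertices K).card ≤ 4 := by
  decide

theorem masks_lt : ∀ K ∈ tripleMasks ++ quadrupleMasks, K < 2 ^ 10 := by
  decide

theorem exists_vertex_of_lt : ∀ j < 10, ∃ x : PrismVertex, j = prismCode x := by
  decide

/-! ### Spanning sets for vectors in equilibrium. -/

section Stress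

variable {E : Type*} [AddCommGroup E] [Module ℝ E]

/-- Vectors in equilibrium under a stress on the prism and the two stretched non-edges lie in a
space spanned by four of them, apart from those with zero stress; if zero-stress vertices are
adjacent, three suffice. -/
theorem exists_spanning_of_stress (Ω : Matrix PrismVertex PrismVertex ℝ)
    (hsymm : ∀ x y, Ω x y = Ω y x) (hdiag : ∀ x, Ω x x = 0 → ∀ y, Ω x y = 0)
    (hsupp : ∀ x y, x ≠ y → ¬ pentagonalPrism.Adj x y → (Ω x y ≠ 0 ↔ stretched x y = true))
    (p : PrismVertex → E) (hrel : ∀ x, ∑ y, Ω x y • p y = 0)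
    (hpar : ∀ x y, pentagonalPrism.Adj x y → ∀ c : ℝ, p y ≠ c • p x) :
    ∃ T : Set PrismVertex, (∀ x, prismCode x ∈ [0, 2, 7, 9] → x ∈ T) ∧
      ((∃ F : Finset PrismVertex, F.card ≤ 3 ∧ ∀ x ∈ T, p x ∈ Submodule.span ℝ (p '' F)) ∨
       ((∃ F : Finset PrismVertex, F.card ≤ 4 ∧ ∀ x ∈ T, p x ∈ Submodule.span ℝ (p '' F)) ∧
        ∀ x y, x ∉ T → y ∉ T → ¬ pentagonalPrism.Adj x y)) := by
  classical
  -- Only the edges need bits: the two stretched non-edges always carry stress.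
  set m : ℕ := Nat.ofBits fun k : Fin 15 =>
    decide (Ω (prismEdge k).1 (prismEdge k).2 ≠ 0) with hm
  have hmlt : m < 2 ^ 15 := Nat.ofBits_lt_two_pow _
  have hbit : ∀ k x y, k < 15 → (prismEdge k = (x, y) ∨ prismEdge k = (y, x)) →
      (m.testBit k = true ↔ Ω x y ≠ 0) := by
    intro k x y hk h
    rw [hm, Nat.testBit_ofBits_lt _ _ hk]
    rcases h with h | h
    · simp [h]
    · simp [h, hsymm x y]
  have hstr : ∀ x y, stretched x y = true → x ≠ y ∧ Ω x y ≠ 0 := fun x y h =>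
    have h' := not_adj_of_stretched x y h
    ⟨h'.2, (hsupp x y h'.2 h'.1).2 h⟩
  have hrow : ∀ d ∈ prismTable, ∀ x, d.1 = prismCode x → ∀ j,
      ((rowMask m d).testBit j = true ↔ ∃ y, j = prismCode y ∧ x ≠ y ∧ Ω x y ≠ 0) := by
    intro d hd x hx j
    rw [rowMask_testBit, row_base_testBit hd hx]
    constructor
    · rintro (⟨y, rfl, h⟩ | ⟨e, he, rfl, h⟩)
      · exact ⟨y, rfl, hstr x y h⟩
      · obtain ⟨y, hadj, hy, hlt, hend⟩ := adj_of_row_edges d hd x hx e he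
        exact ⟨y, hy, hadj.ne, (hbit _ _ _ hlt hend).1 h⟩
    · rintro ⟨y, rfl, hne, h⟩
      by_cases hadj : pentagonalPrism.Adj x y
      · obtain ⟨e, he, hy, hlt, hend⟩ := row_edges_of_adj d hd x y hx hadj
        exact Or.inr ⟨e, he, hy, (hbit _ _ _ hlt hend).2 h⟩
      · exact Or.inl ⟨y, rfl, (hsupp x y hne hadj).1 h⟩
  -- At a leaf x with neighbour y, equilibrium reads Ω_xx p_x + Ω_xy p_y = 0 with Ω_xy ≠ 0, which
  -- makes p_y a multiple of p_x.
  have hleaf : ∀ d ∈ prismTable, hasLeaf m d = false := by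
    intro d hd
    rw [← Bool.not_eq_true, hasLeaf, forceNat_eq, List.any_eq_true]
    rintro ⟨e, he, h⟩
    have h := Nat.eq_of_beq_eq_true h
    obtain ⟨x, hx⟩ := exists_vertex_of_row d hd
    obtain ⟨y, hadj, hy, -, -⟩ := adj_of_row_edges d hd x hx e he
    have key : ∀ z, x ≠ z → (Ω x z ≠ 0 ↔ z = y) := by
      intro z hz
      have := hrow d hd x hx (prismCode z)
      rw [h, Nat.testBit_two_pow, hy, decide_eq_true_eq] at this
      constructor
      · intro hz'
        exact (prismCode_injective (this.2 ⟨z, rfl, hz, hz'⟩)).symm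
      · rintro rfl
        obtain ⟨w, hw, -, hw'⟩ := this.1 rfl
        rwa [prismCode_injective hw]
    have hsum := hrel x
    rw [Finset.sum_eq_add x y hadj.ne (fun z _ hz => by
      have : Ω x z = 0 := by
        by_contra hne
        exact hz.2 ((key z (Ne.symm hz.1)).1 hne)
      rw [this, zero_smul]) (by simp) (by simp)] at hsum
    refine hpar x y hadj (-(Ω x y)⁻¹ * Ω x x) ?_
    have hxy : Ω x y ≠ 0 := (key y hadj.ne).2 rfl
    rw [mul_smul, eq_neg_of_add_eq_zero_left hsum, smul_neg, neg_smul, neg_neg,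
      inv_smul_smul₀ hxy]
  have hok := patternOk_of_no_leaf hmlt hleaf
  rw [patternOk, forceList_eq, forceNat_eq] at hok
  set rels := prismTable.map (closedRow m) with hrels
  set T := supportMask rels with hT
  -- A vertex without stressed neighbours contributes the empty mask. Otherwise `hdiag` gives Ω_xx ≠
  -- 0, so the mask of its relation contains x as well.
  have hclosed : ∀ d ∈ prismTable, ∀ x, d.1 = prismCode x →
      closedRow m d = 0 ∨ ((∃ y, x ≠ y ∧ Ω x y ≠ 0) ∧
        ∀ j, (closedRow m d).testBit j = true ↔ ∃ y, j = prismCode y ∧ Ω x y ≠ 0) := by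
    intro d hd x hx
    rw [closedRow, forceNat_eq]
    cases hz : (rowMask m d).beq 0
    · right
      have hz' : rowMask m d ≠ 0 := fun h => by simp [h] at hz
      obtain ⟨j, hj⟩ := Nat.exists_testBit_of_ne_zero hz'
      obtain ⟨y, -, hy⟩ := (hrow d hd x hx j).1 hj
      refine ⟨⟨y, hy⟩, fun j => ?_⟩
      have hxx : Ω x x ≠ 0 := fun h => hy.2 (hdiag x h y)
      rw [cond_false, Nat.testBit_or, Bool.or_eq_true, hrow d hd x hx, Nat.testBit_two_pow,
        decide_eq_true_eq, hx]
      constructor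
      · rintro (⟨z, hz, -, h⟩ | rfl)
        · exact ⟨z, hz, h⟩
        · exact ⟨x, rfl, hxx⟩
      · rintro ⟨z, rfl, h⟩
        by_cases hxz : x = z
        · exact Or.inr (by rw [hxz])
        · exact Or.inl ⟨z, rfl, hxz, h⟩
    · exact Or.inl rfl
  have hclosedUnder : ∀ M : Submodule ℝ E, ∀ r ∈ rels,
      ClosedUnder (fun j => p (prismVertex j)) M r := by
    intro M r hr
    obtain ⟨d, hd, rfl⟩ := List.mem_map.1 hr
    obtain ⟨x, hx⟩ := exists_vertex_of_row d hd
    intro j hj hM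
    rcases hclosed d hd x hx with h | ⟨-, h⟩
    · simp [h] at hj
    · obtain ⟨y, rfl, hy⟩ := (h j).1 hj
      have hsum := hrel x
      rw [← Finset.add_sum_erase _ _ (Finset.mem_univ y)] at hsum
      have hmem : Ω x y • p y ∈ M := by
        rw [eq_neg_of_add_eq_zero_left hsum]
        refine M.neg_mem (M.sum_mem fun z hz => ?_)
        by_cases hxz : Ω x z = 0
        · rw [hxz, zero_smul]; exact M.zero_mem
        · have := hM (prismCode z) (fun h => (Finset.mem_erase.1 hz).1 (prismCode_injective h))
            ((h _).2 ⟨z, rfl, hxz⟩)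
          simp only [prismVertex_prismCode] at this
          exact M.smul_mem _ this
      simpa [prismVertex_prismCode] using (M.smul_mem_iff hy).1 hmem
  have hspan : ∀ K ∈ tripleMasks ++ quadrupleMasks, generates rels T K = true →
      ∀ x ∈ {x | T.testBit (prismCode x) = true},
        p x ∈ Submodule.span ℝ (p '' (maskVertices K : Set PrismVertex)) := by
    intro K hK hgen x hx
    have := maskIn_of_generates hgen
      (hclosedUnder (Submodule.span ℝ (p '' (maskVertices K : Set PrismVertex)))) (by
        intro j hj
        have hj10 : j < 10 := by
          by_contra hcon
          have := Nat.testBit_lt_two_pow (lt_of_lt_of_le (masks_lt K hK)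
            (Nat.pow_le_pow_right two_pos (not_lt.1 hcon)))
          simp [this] at hj
        obtain ⟨y, rfl⟩ := exists_vertex_of_lt j hj10
        refine Submodule.subset_span ⟨y, ?_, by simp [prismVertex_prismCode]⟩
        simpa [maskVertices] using hj) (prismCode x) hx
    simpa [prismVertex_prismCode] using this
  have hTC : ∀ x, prismCode x ∈ [0, 2, 7, 9] → T.testBit (prismCode x) = true := by
    have hex : ∀ x : PrismVertex, prismCode x ∈ [0, 2, 7, 9] → ∃ y, stretched x y = true := by
      decide
    intro x hx
    obtain ⟨y, hy⟩ := hex x hx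
    obtain ⟨d, hd, hdx⟩ := exists_row x
    have hxy := hstr x y hy
    rw [hT, supportMask_testBit]
    refine ⟨closedRow m d, List.mem_map_of_mem hd, ?_⟩
    rcases hclosed d hd x hdx with h | ⟨-, h⟩
    · exfalso
      rw [closedRow, forceNat_eq] at h
      have hbit := (hrow d hd x hdx (prismCode y)).2 ⟨y, rfl, hxy⟩
      cases hz : (rowMask m d).beq 0
      · rw [hz, cond_false] at h
        have h' := congrArg (fun n => n.testBit (prismCode y)) h
        simp [hbit] at h'
      · rw [Nat.eq_of_beq_eq_true hz] at hbit
        simp at hbit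
    · exact (h _).2 ⟨x, rfl, fun h0 => hxy.2 (hdiag x h0 y)⟩
  refine ⟨{x | T.testBit (prismCode x) = true}, hTC, ?_⟩
  cases hadj : adjacentOutside T
  · right
    rw [hadj, cond_false, List.any_eq_true] at hok
    obtain ⟨K, hK, hgen⟩ := hok
    refine ⟨⟨maskVertices K, card_maskVertices_quadruple K hK,
      hspan K (List.mem_append_right _ hK) hgen⟩, ?_⟩
    refine not_adj_of_adjacentOutside_eq_false hadj fun k hk => ?_
    obtain ⟨x, rfl⟩ := exists_vertex_of_lt k (by revert k; decide)
    exact hTC x hk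
  · left
    rw [hadj, cond_true, List.any_eq_true] at hok
    obtain ⟨K, hK, hgen⟩ := hok
    exact ⟨maskVertices K, card_maskVertices_triple K hK,
      hspan K (List.mem_append_left _ hK) hgen⟩

end Stress

/-! ### Moving a vector into a four-dimensional space. -/

/-- Replace `w` by a vector of the four-dimensional space `M`, given a copy in `M` of the at most
three vectors with which its inner products have to be kept. -/
theorem exists_mem_of_card_le_three {E : Type*} [NormedAddCommGroup E] [InnerProductSpace ℝ E]
    [FiniteDimensional ℝ E] {ι : Type*} (s : Finset ι) (hs : s.card ≤ 3) (p q : ι → E)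
    (M : Submodule ℝ E) (hM : Module.finrank ℝ M = 4) (hq : ∀ i ∈ s, q i ∈ M)
    (hpq : ∀ i ∈ s, ∀ j ∈ s, inner ℝ (q i) (q j) = inner ℝ (p i) (p j)) (w : E) :
    ∃ w' ∈ M, inner ℝ w' w' = inner ℝ w w ∧ ∀ i ∈ s, inner ℝ w' (q i) = inner ℝ w (p i) := by
  classical
  set P := Submodule.span ℝ (p '' s) with hP
  set Q := Submodule.span ℝ (q '' s) with hQ
  have hQM : Q ≤ M := Submodule.span_le.2 (Set.image_subset_iff.2 hq)
  have hQdim : Module.finrank ℝ Q ≤ 3 := by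
    have h1 := finrank_span_finset_le_card (R := ℝ) (s.image q)
    rw [Finset.coe_image] at h1
    exact h1.trans (Finset.card_image_le.trans hs)
  -- The copies span at most three of the four dimensions of `M`, which leaves a unit vector
  -- orthogonal to them.
  obtain ⟨e, heM, heQ, hne⟩ : ∃ e ∈ M, (∀ i ∈ s, inner ℝ e (q i) = 0) ∧ ‖e‖ = 1 := by
    have hlt : Q < M := lt_of_le_of_ne hQM (by
      intro h
      rw [h] at hQdim
      omega)
    obtain ⟨y, hyM, hyQ⟩ := SetLike.exists_of_lt hlt
    set z := y - Q.starProjection y with hz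
    have hz0 : z ≠ 0 := by
      intro h
      rw [hz, sub_eq_zero] at h
      exact hyQ (h ▸ Q.starProjection_apply_mem y)
    have hzQ : ∀ i ∈ s, inner ℝ z (q i) = 0 := fun i hi =>
      Submodule.inner_left_of_mem_orthogonal
        (Submodule.subset_span (Set.mem_image_of_mem q hi) : q i ∈ Q)
        (Q.sub_starProjection_mem_orthogonal y)
    refine ⟨‖z‖⁻¹ • z, M.smul_mem _ (M.sub_mem hyM (hQM (Q.starProjection_apply_mem y))),
      fun i hi => ?_, ?_⟩
    · rw [inner_smul_left, hzQ i hi, mul_zero]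
    · rw [norm_smul, norm_inv, norm_norm, inv_mul_cancel₀ (norm_ne_zero_iff.2 hz0)]
  -- The projection of `w` is copied with the same coefficients; the missing length ‖w - x‖ is
  -- supplied along `e`.
  set x := P.starProjection w with hx
  obtain ⟨c, hc⟩ : ∃ c : ι → ℝ, ∑ i ∈ s, c i • p i = x := by
    have hxP : x ∈ P := P.starProjection_apply_mem w
    rw [hP] at hxP
    exact (Submodule.mem_span_image_finset_iff_exists_fun' ℝ).1 hxP
  set x' := ∑ i ∈ s, c i • q i with hx'
  have hwx : ∀ i ∈ s, inner ℝ w (p i) = inner ℝ x (p i) := by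
    intro i hi
    have := Submodule.inner_left_of_mem_orthogonal (Submodule.subset_span ⟨i, hi, rfl⟩ : p i ∈ P)
        (P.sub_starProjection_mem_orthogonal w)
    rwa [inner_sub_left, sub_eq_zero] at this
  have hx'q : ∀ i ∈ s, inner ℝ x' (q i) = inner ℝ x (p i) := by
    intro i hi
    rw [← hc, hx', sum_inner, sum_inner]
    exact Finset.sum_congr rfl fun j hj => by
      rw [inner_smul_left, inner_smul_left, hpq j hj i hi]
  have hx'x' : inner ℝ x' x' = inner ℝ x x := by
    conv_lhs => rw [hx', inner_sum]
    conv_rhs => rw [← hc, inner_sum]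
    rw [hc, ← hx']
    exact Finset.sum_congr rfl fun j hj => by
      rw [inner_smul_right, inner_smul_right, hx'q j hj]
  have hex' : inner ℝ e x' = 0 := by
    rw [hx', inner_sum]
    exact Finset.sum_eq_zero fun j hj => by rw [inner_smul_right, heQ j hj, mul_zero]
  refine ⟨x' + ‖w - x‖ • e, M.add_mem (M.sum_mem fun i hi => M.smul_mem _ (hq i hi))
    (M.smul_mem _ heM), ?_, fun i hi => ?_⟩
  · have horth : inner ℝ (w - x) x = 0 :=
      Submodule.inner_left_of_mem_orthogonal (P.starProjection_apply_mem w)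
        (P.sub_starProjection_mem_orthogonal w)
    have hw : inner ℝ w w = inner ℝ x x + ‖w - x‖ * ‖w - x‖ := by
      conv_lhs => rw [← sub_add_cancel w x]
      rw [inner_add_left, inner_add_right, inner_add_right, horth, real_inner_comm (w - x) x, horth,
        real_inner_self_eq_norm_mul_norm (w - x)]
      ring
    rw [inner_add_left, inner_add_right, inner_add_right, inner_smul_left, inner_smul_right,
      inner_smul_right, inner_smul_left, hex', real_inner_comm e x', hex', hx'x', hw,
      real_inner_self_eq_norm_mul_norm e, hne]
    simp
  · rw [inner_add_left, inner_smul_left, heQ i hi, mul_zero, add_zero, hx'q i hi, hwx i hi]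

/-! ### Semidefinite duality and complementary slackness. -/

open Matrix in
open scoped MatrixOrder in
/-- Equilibrium form of complementary slackness. -/
theorem exists_gram_in_equilibrium {V : Type*} [Fintype V] [DecidableEq V]
    (X Ω : Matrix V V ℝ) (hX : X.PosSemidef) (hΩ : Ω.PosSemidef)
    (h : ∑ i, ∑ j, Ω i j * X i j = 0) :
    ∃ p : V → EuclideanSpace ℝ V, (∀ i j, inner ℝ (p i) (p j) = X i j) ∧
      ∀ i, ∑ j, Ω i j • p j = 0 := by
  obtain ⟨B, hB⟩ : ∃ B : Matrix V V ℝ, X = star B * B :=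
    CStarAlgebra.nonneg_iff_eq_star_mul_self.1 (Matrix.nonneg_iff_posSemidef.2 hX)
  have hXB : ∀ i j, X i j = ∑ k, B k i * B k j := by
    intro i j
    rw [hB, Matrix.mul_apply]
    simp [Matrix.star_apply]
  have hrow : ∀ k, Ω *ᵥ B k = 0 := by
    -- For X = BᵀB the pairing of Ω with X is the sum of the values of the form Ω on the rows of B.
    -- These are nonnegative, so all vanish, and a null vector of a semidefinite form lies in its
    -- kernel.
    have hnn : ∀ k, 0 ≤ star (B k) ⬝ᵥ Ω *ᵥ B k := fun k => hΩ.dotProduct_mulVec_nonneg _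
    have hsum : ∑ k, star (B k) ⬝ᵥ Ω *ᵥ B k = 0 := by
      rw [← h]
      simp only [dotProduct, mulVec, Pi.star_apply, star_trivial, Finset.mul_sum, hXB]
      rw [Finset.sum_comm]
      refine Finset.sum_congr rfl fun i _ => ?_
      rw [Finset.sum_comm]
      exact Finset.sum_congr rfl fun j _ => Finset.sum_congr rfl fun k _ => by ring
    intro k
    rw [← hΩ.dotProduct_mulVec_zero_iff]
    exact (Finset.sum_eq_zero_iff_of_nonneg fun k _ => hnn k).1 hsum k (Finset.mem_univ k)
  refine ⟨fun i => WithLp.toLp 2 fun k => B k i, fun i j => ?_, fun i => ?_⟩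
  · rw [hXB, PiLp.inner_apply]
    simp [mul_comm]
  · ext k
    have := congrFun (hrow k) i
    simpa [mulVec, dotProduct] using this

-- By homogeneity only unit vectors matter, and compactness of the sphere makes positivity there an
-- open condition.
open Matrix in
theorem isOpen_setOf_forall_quadratic_pos (V : Type*) [Fintype V] :
    IsOpen {X : Matrix V V ℝ | ∀ v : V → ℝ, v ≠ 0 → 0 < v ⬝ᵥ X *ᵥ v} := by
  have hset : {X : Matrix V V ℝ | ∀ v : V → ℝ, v ≠ 0 → 0 < v ⬝ᵥ X *ᵥ v} =
      {X : Matrix V V ℝ | ∀ v ∈ Metric.sphere (0 : V → ℝ) 1, 0 < v ⬝ᵥ X *ᵥ v} := by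
    ext X
    refine ⟨fun h v hv => h v (Metric.ne_of_mem_sphere hv one_ne_zero), fun h v hv => ?_⟩
    have hn : ‖v‖ ≠ 0 := norm_ne_zero_iff.2 hv
    have := h (‖v‖⁻¹ • v) (by simp [norm_smul, hn])
    rw [mulVec_smul, dotProduct_smul, smul_dotProduct, smul_smul, smul_eq_mul] at this
    exact pos_of_mul_pos_right this (by positivity)
  rw [hset, isOpen_iff_eventually]
  intro X hX
  refine (isCompact_sphere (0 : V → ℝ) 1).eventually_forall_of_forall_eventually fun v hv => ?_
  have hcont : Continuous fun z : Matrix V V ℝ × (V → ℝ) => z.2 ⬝ᵥ z.1 *ᵥ z.2 := by fun_prop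
  exact hcont.continuousAt.eventually (lt_mem_nhds (hX v hv))

open Matrix in
/-- A linear objective attains its maximum over the completions of a partial matrix. -/
theorem exists_completion_isMax {V : Type*} [Fintype V] [DecidableEq V] (G : SimpleGraph V)
    (X₀ : Matrix V V ℝ) (hX₀ : X₀.PosSemidef) (C : Matrix V V ℝ) :
    ∃ X : Matrix V V ℝ, X.PosSemidef ∧ SameGPartial G X₀ X ∧
      ∀ Y : Matrix V V ℝ, Y.PosSemidef → SameGPartial G X₀ Y →
        ∑ i, ∑ j, C i j * Y i j ≤ ∑ i, ∑ j, C i j * X i j := by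
  set S : Set (Matrix V V ℝ) := {Y | Y.PosSemidef ∧ SameGPartial G X₀ Y} with hS
  have hbound : ∀ Y ∈ S, ∀ i j, |Y i j| ≤ X₀ i i + X₀ j j := by
    rintro Y ⟨hY, hd, -⟩ i j
    have hs : Y j i = Y i j := by simpa using hY.1.apply i j
    have h1 := hY.dotProduct_mulVec_nonneg (Pi.single i 1 + Pi.single j 1)
    have h2 := hY.dotProduct_mulVec_nonneg (Pi.single i 1 - Pi.single j 1)
    have hi := hY.diag_nonneg (i := i)
    have hj := hY.diag_nonneg (i := j)
    simp [mulVec_add, mulVec_sub, add_dotProduct, sub_dotProduct, hs] at h1 h2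
    rw [hd i, hd j, abs_le]
    constructor <;> linarith
  have hclosed : IsClosed S := by
    have : S = {Y | (∀ i j, Y j i = Y i j) ∧ (∀ v, 0 ≤ star v ⬝ᵥ Y *ᵥ v) ∧
        (∀ i, X₀ i i = Y i i) ∧ ∀ i j, G.Adj i j → X₀ i j = Y i j} := by
      ext Y
      rw [hS, Set.mem_ofPred_eq, Set.mem_ofPred_eq, posSemidef_iff_dotProduct_mulVec, SameGPartial,
        Matrix.IsHermitian.ext_iff, and_assoc]
      simp only [star_trivial]
    rw [this]
    simp only [Set.ofPred_and, Set.ofPred_forall]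
    refine IsClosed.inter ?_ (IsClosed.inter ?_ (IsClosed.inter ?_ ?_))
    · exact isClosed_iInter fun i => isClosed_iInter fun j =>
        isClosed_eq (by fun_prop) (by fun_prop)
    · exact isClosed_iInter fun v => isClosed_le (by fun_prop) (by fun_prop)
    · exact isClosed_iInter fun i => isClosed_eq (by fun_prop) (by fun_prop)
    · exact isClosed_iInter fun i => isClosed_iInter fun j => isClosed_iInter fun _ =>
        isClosed_eq (by fun_prop) (by fun_prop)
  have hcompact : IsCompact S := by
    refine IsCompact.of_isClosed_subset (s := Set.pi Set.univ fun i => Set.pi Set.univ fun j =>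
      Set.Icc (-(X₀ i i + X₀ j j)) (X₀ i i + X₀ j j))
      (isCompact_univ_pi fun i => isCompact_univ_pi fun j => isCompact_Icc) hclosed ?_
    intro Y hY i _ j _
    exact abs_le.1 (hbound Y hY i j)
  obtain ⟨X, hX, hmax⟩ := hcompact.exists_isMaxOn
    ⟨X₀, hX₀, fun _ => rfl, fun _ _ _ => rfl⟩
    (f := fun Y : Matrix V V ℝ => ∑ i, ∑ j, C i j * Y i j) (by fun_prop)
  exact ⟨X, hX.1, hX.2, fun Y hY hY' => hmax ⟨hY, hY'⟩⟩

open Matrix in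
/-- The maximum of a linear objective supported on non-edges over all positive semidefinite
completions of a positive definite partial matrix is attained and certified by a stress. -/
theorem exists_completion_with_stress {V : Type*} [Fintype V] [DecidableEq V] (G : SimpleGraph V)
    (X₀ : Matrix V V ℝ) (hX₀ : X₀.PosDef) (C : Matrix V V ℝ) (hC : ∀ i j, C i j = C j i)
    (hC0 : C ≠ 0) (hCd : ∀ i, C i i = 0) (hCG : ∀ i j, G.Adj i j → C i j = 0) :
    ∃ X Ω : Matrix V V ℝ, X.PosSemidef ∧ SameGPartial G X₀ X ∧ Ω.PosSemidef ∧
      ∑ i, ∑ j, Ω i j * X i j = 0 ∧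
      ∃ τ : ℝ, 0 < τ ∧ ∀ i j, i ≠ j → ¬ G.Adj i j → Ω i j = -τ * C i j := by
  obtain ⟨X, hX, hXG, hmax⟩ := exists_completion_isMax G X₀ hX₀.posSemidef C
  set obj : Matrix V V ℝ →ₗ[ℝ] ℝ :=
    { toFun := fun Y => ∑ i, ∑ j, C i j * Y i j
      map_add' := fun Y Z => by simp [mul_add, Finset.sum_add_distrib]
      map_smul' := fun c Y => by
        simp only [Matrix.smul_apply, smul_eq_mul, RingHom.id_apply, Finset.mul_sum]
        exact Finset.sum_congr rfl fun i _ => Finset.sum_congr rfl fun j _ => by ring }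
    with hobj
  have hobjsingle : ∀ i j, obj (Matrix.single i j 1) = C i j := by
    intro i j
    change ∑ a, ∑ b, C a b * Matrix.single i j (1 : ℝ) a b = _
    rw [Finset.sum_eq_single i (fun a _ ha => by simp [ha.symm]) (by simp),
      Finset.sum_eq_single j (fun b _ hb => by simp [hb.symm]) (by simp)]
    simp
  have hobjC : 0 < obj C := by
    obtain ⟨i, j, hij⟩ : ∃ i j, C i j ≠ 0 := by
      by_contra! h
      exact hC0 (Matrix.ext h)
    refine Finset.sum_pos' (fun i _ => Finset.sum_nonneg fun j _ => mul_self_nonneg _)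
      ⟨i, Finset.mem_univ i, ?_⟩
    exact Finset.sum_pos' (fun j _ => mul_self_nonneg _)
      ⟨j, Finset.mem_univ j, mul_self_pos.2 hij⟩
  -- Matrices in `P` and `B` need not be symmetric: `B` fixes only the sums of opposite edge
  -- entries. So the separation takes place in the full matrix space, where `P` is open, and
  -- symmetry of the stress comes out at the end.
  set P : Set (Matrix V V ℝ) := {Y | ∀ v : V → ℝ, v ≠ 0 → 0 < v ⬝ᵥ Y *ᵥ v} with hP
  set B : Set (Matrix V V ℝ) := {Y | (∀ i, Y i i = X₀ i i) ∧
    (∀ i j, G.Adj i j → Y i j + Y j i = 2 * X₀ i j) ∧ obj X < obj Y} with hB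
  have hPsmul : ∀ Y ∈ P, ∀ t : ℝ, 0 < t → t • Y ∈ P := by
    intro Y hY t ht v hv
    rw [smul_mulVec, dotProduct_smul, smul_eq_mul]
    exact mul_pos ht (hY v hv)
  have hPadd : ∀ Y ∈ P, ∀ Z ∈ P, Y + Z ∈ P := by
    intro Y hY Z hZ v hv
    rw [add_mulVec, dotProduct_add]
    exact add_pos (hY v hv) (hZ v hv)
  have hPconv : Convex ℝ P := by
    rw [convex_iff_forall_pos]
    intro Y hY Z hZ a b ha hb _
    exact hPadd _ (hPsmul Y hY a ha) _ (hPsmul Z hZ b hb)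
  have hX₀s : ∀ i j, X₀ j i = X₀ i j := fun i j => by simpa using hX₀.1.apply i j
  have hXs : ∀ i j, X j i = X i j := fun i j => by simpa using hX.1.apply i j
  have hBconv : Convex ℝ B := by
    rintro Y ⟨hY1, hY2, hY3⟩ Z ⟨hZ1, hZ2, hZ3⟩ a b ha hb hab
    refine ⟨fun i => ?_, fun i j hij => ?_, ?_⟩
    · simp only [Matrix.add_apply, Matrix.smul_apply, smul_eq_mul, hY1, hZ1]
      rw [← add_mul, hab, one_mul]
    · simp only [Matrix.add_apply, Matrix.smul_apply, smul_eq_mul]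
      have : b = 1 - a := by linarith
      subst this
      linear_combination a * hY2 i j hij + (1 - a) * hZ2 i j hij
    · have : b = 1 - a := by linarith
      subst this
      rw [map_add, map_smul, map_smul, smul_eq_mul, smul_eq_mul]
      rcases ha.eq_or_lt with rfl | ha
      · simpa using hZ3
      · nlinarith [mul_lt_mul_of_pos_left hY3 ha, mul_le_mul_of_nonneg_left hZ3.le hb]
  -- The symmetric part of a common point would be a completion beating the maximum.
  have hdisj : Disjoint P B := by
    rw [Set.disjoint_left]
    rintro Z hZP ⟨hZ1, hZ2, hZ3⟩
    set Y : Matrix V V ℝ := (2⁻¹ : ℝ) • (Z + Zᵀ) with hY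
    have hquad : ∀ v : V → ℝ, v ⬝ᵥ Y *ᵥ v = v ⬝ᵥ Z *ᵥ v := by
      intro v
      have : v ⬝ᵥ Zᵀ *ᵥ v = v ⬝ᵥ Z *ᵥ v := by
        rw [mulVec_transpose, dotProduct_comm, ← dotProduct_mulVec]
      rw [hY, smul_mulVec, dotProduct_smul, add_mulVec, dotProduct_add, this, smul_eq_mul]
      ring
    have hYpsd : Y.PosSemidef := by
      refine PosSemidef.of_dotProduct_mulVec_nonneg (Matrix.IsHermitian.ext fun i j => ?_)
        fun v => ?_
      · simp [hY, add_comm]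
      · rw [star_trivial, hquad]
        by_cases hv : v = 0
        · simp [hv]
        · exact (hZP v hv).le
    have hYG : SameGPartial G X₀ Y := by
      refine ⟨fun i => ?_, fun i j hij => ?_⟩
      · simp only [hY, Matrix.smul_apply, Matrix.add_apply, transpose_apply, hZ1, smul_eq_mul]; ring
      · simp only [hY, Matrix.smul_apply, Matrix.add_apply, transpose_apply, hZ2 i j hij, smul_eq_mul]; ring
    have hYobj : obj Y = obj Z := by
      have ht : obj Zᵀ = obj Z := by
        change ∑ i, ∑ j, C i j * Z j i = ∑ i, ∑ j, C i j * Z i j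
        rw [Finset.sum_comm]
        exact Finset.sum_congr rfl fun i _ => Finset.sum_congr rfl fun j _ => by rw [hC]
      rw [hY, map_smul, map_add, ht, smul_eq_mul]
      ring
    have := hmax Y hYpsd hYG
    change obj Y ≤ obj X at this
    rw [hYobj] at this
    exact absurd hZ3 (not_lt.2 this)
  obtain ⟨f, u, hfP, hfB⟩ := geometric_hahn_banach_open hPconv
    (isOpen_setOf_forall_quadratic_pos V) hBconv hdisj
  have hX₀P : X₀ ∈ P := fun v hv => by simpa using hX₀.dotProduct_mulVec_pos hv
  have hfP0 : ∀ Y ∈ P, f Y ≤ 0 := by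
    intro Y hY
    by_contra! hpos
    have := hfP _ (hPsmul Y hY ((|u| + 1) / f Y) (by positivity))
    rw [map_smul, smul_eq_mul, div_mul_cancel₀ _ hpos.ne'] at this
    linarith [le_abs_self u]
  -- Were u negative, a positive multiple of `X₀` would have `f`-value exactly u, against the strict
  -- bound on the cone.
  have hu : 0 ≤ u := by
    by_contra! hneg
    have hf0 : f X₀ < 0 := (hfP X₀ hX₀P).trans hneg
    have := hfP _ (hPsmul X₀ hX₀P (u / f X₀) (div_pos_of_neg_of_neg hneg hf0))
    rw [map_smul, smul_eq_mul, div_mul_cancel₀ _ hf0.ne] at this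
    exact lt_irrefl _ this
  -- `N` is a direction along which partial entries do not change
  have hBdir : ∀ Y : Matrix V V ℝ, (∀ i, Y i i = X₀ i i) →
      (∀ i j, G.Adj i j → Y i j + Y j i = 2 * X₀ i j) → ∀ N : Matrix V V ℝ, (∀ i, N i i = 0) →
      (∀ i j, G.Adj i j → N i j + N j i = 0) → obj X < obj Y + obj N → 0 ≤ f Y + f N := by
    intro Y hY1 hY2 N hN1 hN2 hlt
    rw [← map_add]
    refine hu.trans (hfB _ ⟨fun i => ?_, fun i j hij => ?_, by rwa [map_add]⟩)
    · rw [Matrix.add_apply, hY1, hN1, add_zero]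
    · rw [Matrix.add_apply, Matrix.add_apply]
      linear_combination hY2 i j hij + hN2 i j hij
  have hX1 : ∀ i, X i i = X₀ i i := fun i => (hXG.1 i).symm
  have hX2 : ∀ i j, G.Adj i j → X i j + X j i = 2 * X₀ i j := fun i j hij => by
    rw [hXs i j, hXG.2 i j hij]; ring
  have hCG2 : ∀ i j, G.Adj i j → C i j + C j i = 0 := fun i j hij => by
    rw [hCG i j hij, hCG j i hij.symm, add_zero]
  -- Here positive definiteness of `X₀` acts as Slater's condition: `X₀ + s • C` lies in `B` for
  -- large s, while `f X₀ < u` strictly.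
  have hfC : 0 < f C := by
    by_contra! hle
    set s : ℝ := (|obj X - obj X₀| + 1) / obj C with hs
    have hspos : 0 < s := by positivity
    have hmem : X₀ + s • C ∈ B := by
      refine ⟨fun i => by simp [hCd], fun i j hij => ?_, ?_⟩
      · simp only [Matrix.add_apply, Matrix.smul_apply, hCG i j hij, hCG j i hij.symm, smul_zero, hX₀s i j]
        ring
      · rw [map_add, map_smul, smul_eq_mul, hs, div_mul_cancel₀ _ hobjC.ne']
        linarith [le_abs_self (obj X - obj X₀)]
    have h1 := hfB _ hmem
    have h2 := hfP _ hX₀P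
    rw [map_add, map_smul, smul_eq_mul] at h1
    nlinarith [mul_nonneg hspos.le (neg_nonneg.2 hle)]
  -- Adding `C` to `X` makes the objective strictly larger than the maximum; then any multiple of
  -- `N` may be added without leaving `B`, so `f N` cannot be negative, nor `f (-N)`.
  have hkernel : ∀ N : Matrix V V ℝ, (∀ i, N i i = 0) →
      (∀ i j, G.Adj i j → N i j + N j i = 0) → obj N = 0 → f N = 0 := by
    have key : ∀ N : Matrix V V ℝ, (∀ i, N i i = 0) →
        (∀ i j, G.Adj i j → N i j + N j i = 0) → obj N = 0 → 0 ≤ f N := by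
      intro N hN1 hN2 hN
      by_contra! hneg
      set t : ℝ := (|f X + f C| + 1) / -f N with ht
      have htN : t * f N = -(|f X + f C| + 1) := by
        rw [ht, div_mul_eq_mul_div, div_eq_iff (by linarith)]; ring
      have := hBdir X hX1 hX2 (C + t • N)
        (fun i => by simp [hCd, hN1])
        (fun i j hij => by
          simp only [Matrix.add_apply, Matrix.smul_apply, smul_eq_mul]
          linear_combination hCG2 i j hij + t * hN2 i j hij)
        (by rw [map_add, map_smul, hN, smul_zero]; linarith)
      rw [map_add, map_smul, smul_eq_mul, htN] at this
      linarith [le_abs_self (f X + f C)]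
    intro N hN1 hN2 hN
    refine le_antisymm ?_ (key N hN1 hN2 hN)
    have := key (-N) (fun i => by simp [hN1])
      (fun i j hij => by simp only [Matrix.neg_apply]; linear_combination -hN2 i j hij) (by simp [hN])
    rw [map_neg] at this
    linarith
  -- `X` is a limit both of points of `P`, by adding multiples of the identity, and of points of
  -- `B`, by adding multiples of `C`.
  have hfX : f X = 0 := by
    apply le_antisymm
    · refine le_of_forall_pos_le_add fun ε hε => ?_
      set t : ℝ := ε / (|f 1| + 1) with ht
      have htpos : 0 < t := by positivity
      have hmem : X + t • (1 : Matrix V V ℝ) ∈ P := by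
        intro v hv
        rw [add_mulVec, dotProduct_add, smul_mulVec, one_mulVec, dotProduct_smul, smul_eq_mul]
        refine add_pos_of_nonneg_of_pos (by simpa using hX.dotProduct_mulVec_nonneg v)
          (mul_pos htpos ?_)
        simpa using dotProduct_star_self_pos_iff.2 hv
      have h1 := hfP0 _ hmem
      rw [map_add, map_smul, smul_eq_mul] at h1
      have h2 : t * (|f 1| + 1) = ε := by rw [ht]; field_simp
      nlinarith [neg_abs_le (f 1)]
    · refine le_of_forall_pos_le_add fun ε hε => ?_
      have := hBdir X hX1 hX2 ((ε / f C) • C) (fun i => by simp [hCd])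
        (fun i j hij => by
          simp only [Matrix.smul_apply, smul_eq_mul]
          linear_combination (ε / f C) * hCG2 i j hij)
        (by rw [map_smul, smul_eq_mul]; linarith [mul_pos (div_pos hε hfC) hobjC])
      rwa [map_smul, smul_eq_mul, div_mul_cancel₀ _ hfC.ne'] at this
  set Ω : Matrix V V ℝ := fun i j => -f (Matrix.single i j 1) with hΩ
  have hfsum : ∀ Y : Matrix V V ℝ, ∑ i, ∑ j, Ω i j * Y i j = -f Y := by
    intro Y
    conv_rhs => rw [Matrix.matrix_eq_sum_single Y]
    rw [map_sum, ← Finset.sum_neg_distrib]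
    refine Finset.sum_congr rfl fun i _ => ?_
    rw [map_sum, ← Finset.sum_neg_distrib]
    refine Finset.sum_congr rfl fun j _ => ?_
    have : Matrix.single i j (Y i j) = Y i j • Matrix.single i j (1 : ℝ) := by
      rw [smul_single, smul_eq_mul, mul_one]
    rw [this, map_smul, smul_eq_mul]
    change -f (Matrix.single i j 1) * Y i j = _
    ring
  have hΩsymm : ∀ i j, Ω j i = Ω i j := by
    intro i j
    have := hkernel (Matrix.single i j 1 - Matrix.single j i 1)
      (fun a => by
        simp only [Matrix.sub_apply, single_apply, and_comm]
        split_ifs <;> simp)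
      (fun a b hab => by
        simp only [Matrix.sub_apply, single_apply, and_comm]
        split_ifs <;> simp)
      (by rw [map_sub, hobjsingle, hobjsingle, hC, sub_self])
    rw [map_sub, sub_eq_zero] at this
    change -f _ = -f _
    rw [this]
  refine ⟨X, Ω, hX, hXG, ?_, by rw [hfsum, hfX, neg_zero], f C / obj C, div_pos hfC hobjC,
    fun i j hij hadj => ?_⟩
  · refine PosSemidef.of_dotProduct_mulVec_nonneg (Matrix.IsHermitian.ext fun i j => ?_)
      fun v => ?_
    · rw [star_trivial, hΩsymm]
    · have hquad : star v ⬝ᵥ Ω *ᵥ v = -f (vecMulVec v v) := by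
        rw [← hfsum]
        simp only [dotProduct, mulVec, star_trivial, Finset.mul_sum, vecMulVec_apply]
        exact Finset.sum_congr rfl fun i _ => Finset.sum_congr rfl fun j _ => by ring
      rw [hquad, neg_nonneg]
      refine le_of_forall_pos_le_add fun ε hε => ?_
      set t : ℝ := ε / (|f 1| + 1) with ht
      have htpos : 0 < t := by positivity
      have hmem : vecMulVec v v + t • (1 : Matrix V V ℝ) ∈ P := by
        intro w hw
        rw [add_mulVec, dotProduct_add, smul_mulVec, one_mulVec, dotProduct_smul, smul_eq_mul]
        refine add_pos_of_nonneg_of_pos ?_ (mul_pos htpos ?_)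
        · have hvv : (vecMulVec v v).PosSemidef := by
            simpa using posSemidef_vecMulVec_self_star v
          simpa using hvv.dotProduct_mulVec_nonneg w
        · simpa using dotProduct_star_self_pos_iff.2 hw
      have h1 := hfP0 _ hmem
      rw [map_add, map_smul, smul_eq_mul] at h1
      have h2 : t * (|f 1| + 1) = ε := by rw [ht]; field_simp
      nlinarith [neg_abs_le (f 1)]
  -- Subtracting the right multiple of `C` from the matrix unit of a non-edge makes the objective
  -- vanish, so there `f` is proportional to `C`, with ratio τ.
  · have hdiff := hkernel (Matrix.single i j 1 - (C i j / obj C) • C)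
      (fun a => by
        have : ¬ (i = a ∧ j = a) := fun h => hij (h.1.trans h.2.symm)
        simp [hCd, this])
      (fun a b hab => by
        have h1 : ¬ (i = a ∧ j = b) := fun h => hadj (h.1 ▸ h.2 ▸ hab)
        have h2 : ¬ (i = b ∧ j = a) := fun h => hadj (h.1 ▸ h.2 ▸ hab.symm)
        simp [h1, h2, hCG a b hab, hCG b a hab.symm])
      (by rw [map_sub, map_smul, hobjsingle, smul_eq_mul, div_mul_cancel₀ _ hobjC.ne', sub_self])
    rw [map_sub, map_smul, smul_eq_mul, sub_eq_zero] at hdiff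
    change -f _ = _
    rw [hdiff]
    ring

/-! ### Placing all vertices in a four-dimensional space. -/

theorem exists_submodule_ge_finrank_eq {K E : Type*} [DivisionRing K] [AddCommGroup E] [Module K E]
    [FiniteDimensional K E] (P : Submodule K E) (n : ℕ) (hP : Module.finrank K P ≤ n)
    (hn : n ≤ Module.finrank K E) : ∃ M : Submodule K E, P ≤ M ∧ Module.finrank K M = n := by
  induction n, hP using Nat.le_induction with
  | base => exact ⟨P, le_rfl, rfl⟩
  | succ n _ ih =>
    obtain ⟨M, hPM, hM⟩ := ih (by omega)
    obtain ⟨y, -, hy⟩ := SetLike.exists_of_lt (lt_top_iff_ne_top.2 (by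
      rintro rfl
      rw [finrank_top] at hM
      omega : M ≠ ⊤))
    refine ⟨M ⊔ Submodule.span K {y}, hPM.trans le_sup_left, ?_⟩
    rw [Submodule.finrank_sup_span_singleton hy, hM]

section Placement

variable {E : Type*} [NormedAddCommGroup E] [InnerProductSpace ℝ E] [FiniteDimensional ℝ E]

/-- Once the vertices of `U` have been placed in the four-dimensional space `M`, independent
vertices of degree at most three outside `U` can be placed as well. -/
theorem exists_placement_of_independent {V : Type*} [Fintype V] (G : SimpleGraph V)
    [DecidableRel G.Adj] (hdeg : ∀ x, G.degree x ≤ 3) (p q : V → E) (M : Submodule ℝ E)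
    (hM : Module.finrank ℝ M = 4) (U : Set V) (hq : ∀ x ∈ U, q x ∈ M)
    (hdiag : ∀ x ∈ U, inner ℝ (q x) (q x) = inner ℝ (p x) (p x))
    (hadj : ∀ x ∈ U, ∀ y ∈ U, G.Adj x y → inner ℝ (q x) (q y) = inner ℝ (p x) (p y))
    (hU : ∀ x y, x ∉ U → y ∉ U → ¬ G.Adj x y)
    (hnbr : ∀ w ∉ U, ∀ x y, G.Adj w x → G.Adj w y →
      inner ℝ (q x) (q y) = inner ℝ (p x) (p y)) :
    ∃ q' : V → E, (∀ x, q' x ∈ M) ∧ (∀ x, inner ℝ (q' x) (q' x) = inner ℝ (p x) (p x)) ∧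
      ∀ x y, G.Adj x y → inner ℝ (q' x) (q' y) = inner ℝ (p x) (p y) := by
  classical
  have hnU : ∀ w ∉ U, ∀ x, G.Adj w x → x ∈ U := fun w hw x hx => by
    by_contra h
    exact hU w x hw h hx
  have hplace : ∀ w, ∃ w' : E, w ∉ U → w' ∈ M ∧ inner ℝ w' w' = inner ℝ (p w) (p w) ∧
      ∀ x, G.Adj w x → inner ℝ w' (q x) = inner ℝ (p w) (p x) := by
    intro w
    by_cases hw : w ∈ U
    · exact ⟨0, fun h => absurd hw h⟩
    · obtain ⟨w', h1, h2, h3⟩ := exists_mem_of_card_le_three (G.neighborFinset w) (hdeg w) p q M hM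
        (fun x hx => hq x (hnU w hw x ((G.mem_neighborFinset w x).1 hx)))
        (fun x hx y hy => hnbr w hw x y ((G.mem_neighborFinset w x).1 hx)
          ((G.mem_neighborFinset w y).1 hy)) (p w)
      exact ⟨w', fun _ => ⟨h1, h2, fun x hx => h3 x ((G.mem_neighborFinset w x).2 hx)⟩⟩
  choose r hr using hplace
  refine ⟨fun x => if x ∈ U then q x else r x, fun x => ?_, fun x => ?_, fun x y hxy => ?_⟩
  · by_cases hx : x ∈ U
    · simpa [hx] using hq x hx
    · simpa [hx] using (hr x hx).1
  · by_cases hx : x ∈ U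
    · simpa only [if_pos hx] using hdiag x hx
    · simpa only [if_neg hx] using (hr x hx).2.1
  · by_cases hx : x ∈ U <;> by_cases hy : y ∈ U
    · simpa only [if_pos hx, if_pos hy] using hadj x hx y hy hxy
    · simp only [if_pos hx, if_neg hy]
      rw [real_inner_comm, (hr y hy).2.2 x hxy.symm, real_inner_comm]
    · simpa only [if_neg hx, if_pos hy] using (hr x hx).2.2 y hxy
    · exact absurd hxy (hU x y hx hy)

theorem degree_pentagonalPrism_le : ∀ x, pentagonalPrism.degree x ≤ 3 := by
  decide

theorem exists_placement_of_spanning (hE : 4 ≤ Module.finrank ℝ E) (p : PrismVertex → E)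
    (T : Set PrismVertex) (hT : ∀ x, prismCode x ∈ [0, 2, 7, 9] → x ∈ T)
    (h : (∃ F : Finset PrismVertex, F.card ≤ 3 ∧ ∀ x ∈ T, p x ∈ Submodule.span ℝ (p '' F)) ∨
       ((∃ F : Finset PrismVertex, F.card ≤ 4 ∧ ∀ x ∈ T, p x ∈ Submodule.span ℝ (p '' F)) ∧
        ∀ x y, x ∉ T → y ∉ T → ¬ pentagonalPrism.Adj x y)) :
    ∃ M : Submodule ℝ E, Module.finrank ℝ M = 4 ∧ ∃ q : PrismVertex → E, (∀ x, q x ∈ M) ∧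
      (∀ x, inner ℝ (q x) (q x) = inner ℝ (p x) (p x)) ∧
      ∀ x y, pentagonalPrism.Adj x y → inner ℝ (q x) (q y) = inner ℝ (p x) (p y) := by
  classical
  have hspan : ∀ F : Finset PrismVertex, F.card ≤ 4 →
      ∃ M : Submodule ℝ E, Submodule.span ℝ (p '' F) ≤ M ∧ Module.finrank ℝ M = 4 := by
    intro F hF
    refine exists_submodule_ge_finrank_eq _ 4 ?_ hE
    have h1 := finrank_span_finset_le_card (R := ℝ) (F.image p)
    rw [Finset.coe_image] at h1
    exact h1.trans (Finset.card_image_le.trans hF)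
  rcases h with ⟨F, hF, hFT⟩ | ⟨⟨F, hF, hFT⟩, hindep⟩
  · obtain ⟨M, hFM, hM⟩ := hspan F (hF.trans (by norm_num))
    refine ⟨M, hM, ?_⟩
    have hplace : ∀ w, ∃ w' ∈ M, inner ℝ w' w' = inner ℝ (p w) (p w) ∧
        ∀ x ∈ F, inner ℝ w' (p x) = inner ℝ (p w) (p x) := fun w =>
      exists_mem_of_card_le_three F hF p p M hM
        (fun x hx => hFM (Submodule.subset_span (Set.mem_image_of_mem p hx)))
        (fun _ _ _ _ => rfl) (p w)
    choose r hrM hrr hrF using hplace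
    -- Inner products with the at most three generators determine those with every vector of `T`.
    have hrT : ∀ w, ∀ x ∈ T, inner ℝ (r w) (p x) = inner ℝ (p w) (p x) := by
      intro w x hx
      obtain ⟨c, hc⟩ := (Submodule.mem_span_image_finset_iff_exists_fun' ℝ).1 (hFT x hx)
      rw [← hc, inner_sum, inner_sum]
      exact Finset.sum_congr rfl fun y hy => by
        rw [inner_smul_right, inner_smul_right, hrF w y hy]
    -- Outside a₀, a₂, b₂, b₄ the prism consists of the paths a₁b₁b₀ and a₄a₃b₃. Once their
    -- midpoints b₁ and a₃ are placed, the remaining vertices are independent. The midpoints are not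
    -- adjacent and have no common neighbour, so their mutual inner product, which may change, is
    -- never needed.
    set R : Set PrismVertex := {x | prismCode x ∈ [3, 6]} with hR
    set q : PrismVertex → E := fun x => if x ∈ T then p x else r x with hq
    have hqM : ∀ x, q x ∈ M := by
      intro x
      by_cases hx : x ∈ T
      · simpa [hq, hx] using hFM (hFT x hx)
      · simpa [hq, hx] using hrM x
    have hqq : ∀ x y, x = y ∨ x ∈ T ∨ y ∈ T → inner ℝ (q x) (q y) = inner ℝ (p x) (p y) := by
      intro x y hxy
      by_cases hx : x ∈ T <;> by_cases hy : y ∈ T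
      · simp only [hq, if_pos hx, if_pos hy]
      · simp only [hq, if_pos hx, if_neg hy]
        rw [real_inner_comm, hrT y x hx, real_inner_comm]
      · simp only [hq, if_neg hx, if_pos hy]
        exact hrT x y hy
      · obtain rfl : x = y := by tauto
        simp only [hq, if_neg hx]
        exact hrr x
    have hout : ∀ x, x ∉ T → prismCode x ∉ [0, 2, 7, 9] := fun x hx h => hx (hT x h)
    have hUR : ∀ x y : PrismVertex, prismCode x ∉ [0, 2, 7, 9] → prismCode y ∉ [0, 2, 7, 9] →
        prismCode x ∉ [3, 6] → prismCode y ∉ [3, 6] → ¬ pentagonalPrism.Adj x y := by decide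
    have hRR : ∀ x y : PrismVertex, prismCode x ∈ [3, 6] → prismCode y ∈ [3, 6] →
        ¬ pentagonalPrism.Adj x y := by decide
    have hRW : ∀ w x y : PrismVertex, prismCode x ∈ [3, 6] → prismCode y ∈ [3, 6] → x ≠ y →
        pentagonalPrism.Adj w x → ¬ pentagonalPrism.Adj w y := by decide
    have hindep : ∀ x y, x ∉ T ∪ R → y ∉ T ∪ R → ¬ pentagonalPrism.Adj x y := by
      intro x y hx hy
      rw [Set.mem_union, not_or] at hx hy
      exact hUR x y (hout x hx.1) (hout y hy.1) hx.2 hy.2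
    refine exists_placement_of_independent pentagonalPrism degree_pentagonalPrism_le p q M hM
      (T ∪ R) (fun x _ => hqM x) (fun x _ => hqq x x (Or.inl rfl)) ?_ hindep ?_
    · intro x hx y hy hxy
      refine hqq x y (Or.inr ?_)
      by_contra! hcon
      exact hRR x y (hx.resolve_left hcon.1) (hy.resolve_left hcon.2) hxy
    · intro w hw x y hx hy
      have hmem : ∀ z, pentagonalPrism.Adj w z → z ∈ T ∪ R := fun z hz => by
        by_contra h
        exact hindep w z hw h hz
      refine hqq x y ?_
      by_contra! hcon
      exact hRW w x y ((hmem x hx).resolve_left hcon.2.1) ((hmem y hy).resolve_left hcon.2.2)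
        hcon.1 hx hy
  · obtain ⟨M, hFM, hM⟩ := hspan F hF
    exact ⟨M, hM, exists_placement_of_independent pentagonalPrism degree_pentagonalPrism_le p p M
      hM T (fun x hx => hFM (hFT x hx)) (fun _ _ => rfl) (fun _ _ _ _ _ => rfl) hindep
      (fun _ _ _ _ _ _ => rfl)⟩

end Placement

/-! ### Passage from positive definite to semidefinite matrices. -/

/-- Vectors in `ℝᵏ` whose Gram matrix agrees with `X` on the diagonal and on the edges of `G`. -/
def IsGramRepresentation {V : Type*} (G : SimpleGraph V) (k : ℕ) (X : Matrix V V ℝ)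
    (q : V → EuclideanSpace ℝ (Fin k)) : Prop :=
  (∀ x, inner ℝ (q x) (q x) = X x x) ∧ ∀ x y, G.Adj x y → inner ℝ (q x) (q y) = X x y

theorem rank_gram_le {V : Type*} [Fintype V] {k : ℕ} (q : V → EuclideanSpace ℝ (Fin k)) :
    (Matrix.gram ℝ q).rank ≤ k := by
  have h : Matrix.gram ℝ q =
      (Matrix.of fun x i => q x i) * (Matrix.of fun x i => q x i).transpose := by
    ext x y
    simp [Matrix.gram_apply, Matrix.mul_apply, PiLp.inner_apply, mul_comm]
  rw [h]
  exact (Matrix.rank_mul_le_left _ _).trans ((Matrix.rank_le_card_width _).trans (by simp))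

/-- By compactness, Gram representations of fixed dimension for all positive definite matrices
give low-rank completions for all positive semidefinite ones. -/
theorem hasLowRankCompletions_of_posDef {V : Type*} [Fintype V] (G : SimpleGraph V) (k : ℕ)
    (h : ∀ X : Matrix V V ℝ, X.PosDef → ∃ q, IsGramRepresentation G k X q) :
    HasLowRankCompletions G k := by
  classical
  intro X hX
  set ε : ℕ → ℝ := fun n => 1 / ((n : ℝ) + 1) with hε
  have hεpos : ∀ n, 0 < ε n := fun n => by positivity
  have hεle : ∀ n, ε n ≤ 1 := fun n => by
    rw [hε]
    exact (div_le_one (by positivity)).2 (by linarith [(Nat.cast_nonneg n : (0 : ℝ) ≤ n)])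
  have hεlim : Filter.Tendsto ε Filter.atTop (nhds 0) := tendsto_one_div_add_atTop_nhds_zero_nat
  have hpd : ∀ n, (X + ε n • (1 : Matrix V V ℝ)).PosDef := fun n =>
    Matrix.PosDef.posSemidef_add hX (Matrix.PosDef.one.smul (hεpos n))
  choose q hqd hqe using fun n => h _ (hpd n)
  -- The perturbed diagonal bounds the vectors uniformly; since all of them live in the same ℝᵏ, the
  -- rank bound survives the limit.
  have hK : IsCompact (Set.pi Set.univ fun x : V =>
      Metric.closedBall (0 : EuclideanSpace ℝ (Fin k)) (Real.sqrt (X x x + 1))) :=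
    isCompact_univ_pi fun x => isCompact_closedBall _ _
  have hqK : ∀ n, q n ∈ Set.pi Set.univ fun x : V =>
      Metric.closedBall (0 : EuclideanSpace ℝ (Fin k)) (Real.sqrt (X x x + 1)) := by
    intro n x _
    rw [mem_closedBall_zero_iff]
    refine Real.le_sqrt_of_sq_le ?_
    rw [← real_inner_self_eq_norm_sq, hqd n x]
    simpa using hεle n
  obtain ⟨p, -, φ, hφ, hlim⟩ := hK.tendsto_subseq hqK
  have hlimx : ∀ x, Filter.Tendsto (fun n => q (φ n) x) Filter.atTop (nhds (p x)) :=
    tendsto_pi_nhds.1 hlim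
  have hεφ : Filter.Tendsto (fun n => ε (φ n)) Filter.atTop (nhds 0) :=
    hεlim.comp hφ.tendsto_atTop
  have hin : ∀ x y, (∀ n, inner ℝ (q n x) (q n y) = X x y + ε n * (1 : Matrix V V ℝ) x y) →
      X x y = inner ℝ (p x) (p y) := by
    intro x y hxy
    have h1 := (hlimx x).inner (𝕜 := ℝ) (hlimx y)
    have h2 : Filter.Tendsto (fun n => X x y + ε (φ n) * (1 : Matrix V V ℝ) x y) Filter.atTop
        (nhds (X x y + 0 * (1 : Matrix V V ℝ) x y)) := (hεφ.mul_const _).const_add _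
    rw [zero_mul, add_zero] at h2
    exact tendsto_nhds_unique (h2.congr fun n => (hxy (φ n)).symm) h1
  exact ⟨Matrix.gram ℝ p, Matrix.posSemidef_gram ℝ p, rank_gram_le p,
    fun x => hin x x fun n => hqd n x, fun x y hxy => hin x y fun n => hqe n x y hxy⟩

/-! ### The upper bound. -/

/-- The indicator matrix of the two stretched non-edges. -/
def stretchMatrix : Matrix PrismVertex PrismVertex ℝ :=
  fun x y => if stretched x y = true then 1 else 0

theorem exists_gramRepresentation_pentagonalPrism (X₀ : Matrix PrismVertex PrismVertex ℝ)
    (hX₀ : X₀.PosDef) : ∃ q, IsGramRepresentation pentagonalPrism 4 X₀ q := by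
  have hcomm : ∀ x y, stretched x y = stretched y x := by decide
  have hirrefl : ∀ x, stretched x x = false := by decide
  obtain ⟨X, Ω, hX, hXG, hΩ, hΩX, τ, hτ, hΩC⟩ := exists_completion_with_stress pentagonalPrism
    X₀ hX₀ stretchMatrix (fun x y => by simp only [stretchMatrix, hcomm x y])
    (fun h => by
      have := congrFun (congrFun h (0, 0)) (2, 1)
      simp [stretchMatrix, show stretched (0, 0) (2, 1) = true by decide] at this)
    (fun x => by simp [stretchMatrix, hirrefl x])
    (fun x y hxy => by
      have : ¬ stretched x y = true := fun h => (not_adj_of_stretched x y h).1 hxy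
      simp [stretchMatrix, this])
  obtain ⟨p, hp, hrel⟩ := exists_gram_in_equilibrium X Ω hX hΩ hΩX
  have hsymm : ∀ x y, Ω x y = Ω y x := fun x y => by simpa using hΩ.1.apply y x
  have hdiag : ∀ x, Ω x x = 0 → ∀ y, Ω x y = 0 := by
    intro x hx y
    have h := (hΩ.dotProduct_mulVec_zero_iff (Pi.single x 1)).1 (by simpa using hx)
    have := congrFun h y
    rw [hsymm]
    simpa using this
  -- The 2 × 2 principal submatrix at an edge is shared with the positive definite `X₀`; a relation
  -- p_y = c p_x would make its form vanish at e_y - c e_x.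
  have hpar : ∀ x y, pentagonalPrism.Adj x y → ∀ c : ℝ, p y ≠ c • p x := by
    intro x y hxy c hc
    have hne : (Pi.single y 1 - c • Pi.single x 1 : PrismVertex → ℝ) ≠ 0 := by
      intro h
      have := congrFun h y
      simp [hxy.ne'] at this
    have hpos := hX₀.dotProduct_mulVec_pos hne
    have hs : X₀ y x = X₀ x y := by simpa using hX₀.1.apply x y
    have h1 : X₀ y y = c * c * X₀ x x := by
      rw [hXG.1 y, hXG.1 x, ← hp, ← hp, hc, inner_smul_left, inner_smul_right]
      simp [mul_assoc]
    have h2 : X₀ x y = c * X₀ x x := by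
      rw [hXG.2 x y hxy, hXG.1 x, ← hp, ← hp, hc, inner_smul_right]
    simp [Matrix.mulVec_sub, Matrix.mulVec_smul, sub_dotProduct, hs, h1, h2] at hpos
    nlinarith
  obtain ⟨T, hT, hspan⟩ := exists_spanning_of_stress Ω hsymm hdiag (fun x y hxy hadj => by
    rw [hΩC x y hxy hadj, stretchMatrix]
    by_cases h : stretched x y = true <;> simp [h, hτ.ne']) p hrel hpar
  obtain ⟨M, hM, q, hqM, hqd, hqe⟩ := exists_placement_of_spanning (by simp) p T hT hspan
  set b := (stdOrthonormalBasis ℝ M).reindex (finCongr hM)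
  have hb : ∀ x y, inner ℝ (b.repr ⟨q x, hqM x⟩) (b.repr ⟨q y, hqM y⟩) = inner ℝ (q x) (q y) :=
    fun x y => by rw [b.repr.inner_map_map]; rfl
  refine ⟨fun x => b.repr ⟨q x, hqM x⟩, fun x => ?_, fun x y hxy => ?_⟩
  · rw [hb, hqd, hp, hXG.1]
  · rw [hb, hqe x y hxy, hp, hXG.2 x y hxy]

/-! ### The lower bound. -/

/-- A vertex of `K₄` for each vertex of the prism, with connected adjacent classes. -/
def prismMinor (x : PrismVertex) : Fin 4 :=
  if x.2 = 1 then 3 else if x.1 = 0 then 0 else if x.1 = 1 then 1 else 2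

/-- Each vertex receives the basis vector of its class. In any completion, unit vectors joined by an
edge within a class have inner product 1 and hence coincide, while an edge between two classes makes
their vectors orthogonal. -/
theorem four_le_of_hasLowRankCompletions {k : ℕ}
    (h : HasLowRankCompletions pentagonalPrism k) : 4 ≤ k := by
  classical
  have hX : (Matrix.gram ℝ fun x : PrismVertex =>
      EuclideanSpace.single (prismMinor x) (1 : ℝ)).PosSemidef := Matrix.posSemidef_gram _ _
  obtain ⟨Y, hY, hrank, hdiag, hedge⟩ := h _ hX
  -- The zero stress is used merely to extract Gram vectors of `Y`.
  obtain ⟨p, hp, -⟩ := exists_gram_in_equilibrium Y 0 hY Matrix.PosSemidef.zero (by simp)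
  have hg : ∀ x y, Matrix.gram ℝ (fun x : PrismVertex =>
      EuclideanSpace.single (prismMinor x) (1 : ℝ)) x y =
        if prismMinor x = prismMinor y then 1 else 0 := by
    intro x y
    simp [Matrix.gram_apply, EuclideanSpace.inner_single_left]
  have hnorm : ∀ x, inner ℝ (p x) (p x) = 1 := fun x => by
    rw [hp, ← hdiag, hg, if_pos rfl]
  have hin : ∀ x y, pentagonalPrism.Adj x y →
      inner ℝ (p x) (p y) = if prismMinor x = prismMinor y then (1 : ℝ) else 0 := fun x y hxy => by
    rw [hp, ← hedge x y hxy, hg]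
  have heq : ∀ x y, pentagonalPrism.Adj x y → prismMinor x = prismMinor y → p x = p y := by
    intro x y hxy hm
    rw [← sub_eq_zero, ← inner_self_eq_zero (𝕜 := ℝ), inner_sub_left, inner_sub_right,
      inner_sub_right, real_inner_comm (p x) (p y), hnorm, hnorm, hin x y hxy, if_pos hm]
    ring
  set v : Fin 4 → PrismVertex := ![(0, 0), (1, 0), (2, 0), (0, 1)]
  have e3 : p (3, 0) = p (2, 0) := heq _ _ (by decide) (by decide)
  have e4 : p (4, 0) = p (2, 0) := (heq _ _ (by decide) (by decide)).trans e3
  have f1 : p (1, 1) = p (0, 1) := heq _ _ (by decide) (by decide)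
  have f2 : p (2, 1) = p (0, 1) := (heq _ _ (by decide) (by decide)).trans f1
  have h01 : inner ℝ (p (0, 0)) (p (1, 0)) = 0 := hin (0, 0) (1, 0) (by decide)
  have h02 : inner ℝ (p (0, 0)) (p (2, 0)) = 0 := e4 ▸ hin (0, 0) (4, 0) (by decide)
  have h03 : inner ℝ (p (0, 0)) (p (0, 1)) = 0 := hin (0, 0) (0, 1) (by decide)
  have h12 : inner ℝ (p (1, 0)) (p (2, 0)) = 0 := hin (1, 0) (2, 0) (by decide)
  have h13 : inner ℝ (p (1, 0)) (p (0, 1)) = 0 := f1 ▸ hin (1, 0) (1, 1) (by decide)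
  have h23 : inner ℝ (p (2, 0)) (p (0, 1)) = 0 := f2 ▸ hin (2, 0) (2, 1) (by decide)
  have hlt : ∀ i j, i < j → inner ℝ (p (v i)) (p (v j)) = 0 := by
    intro i j hij
    fin_cases i <;> fin_cases j <;> first | exact absurd hij (by decide) | assumption
  have hone : Y.submatrix v v = 1 := by
    ext i j
    rw [Matrix.submatrix_apply, ← hp, Matrix.one_apply]
    rcases lt_trichotomy i j with hij | rfl | hij
    · rw [hlt i j hij, if_neg hij.ne]
    · rw [hnorm, if_pos rfl]
    · rw [real_inner_comm, hlt j i hij, if_neg hij.ne']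
  have h4 : (Y.submatrix v v).rank = 4 := by rw [hone, Matrix.rank_one, Fintype.card_fin]
  have hle : (Y.submatrix v v).rank ≤ Y.rank := Matrix.rank_submatrix_le _ _ _
  omega

theorem theorem5p1 : gramDim pentagonalPrism = 4 := by
  refine le_antisymm ?_ (four_le_of_hasLowRankCompletions (gramDim_isLeast pentagonalPrism).1.2)
  exact (gramDim_isLeast pentagonalPrism).2 ⟨by norm_num,
    hasLowRankCompletions_of_posDef pentagonalPrism 4 exists_gramRepresentation_pentagonalPrism⟩
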